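/- Let $K_0$ be a formally real field, let $t\ge 1$, let $X_1,\dots,X_t$ be algebraically independent indeterminates over $K_0$, and put $K=K_0(X_1,\dots,X_t)$. For an algebra $A$ with scalar involution $\overline{\phantom{x}}$ over a field and a scalar $\gamma\neq 0$, the Cayley–Dickson process yields the algebra $(A,\gamma)=A\oplus A$ with $$(a_1,a_2)(b_1,b_2)=(a_1b_1+\gamma\,\overline{b_2}\,a_2,\ a_2\overline{b_1}+b_2a_1),\qquad \overline{(a_1,a_2)}=(\overline{a_1},-a_2),$$ and the norm form of an algebra $A$ with scalar involution is the quadratic form $n_C^{A}$ given by $a\overline{a}=n_C^{A}(a)\cdot 1$. Let $A_t=\left(\frac{X_1,\dots,X_t}{K}\right)$ be the $2^t$-dimensional $K$-algebra obtained from $K$ (with the identity as involution) by applying this process $t$ times with the parameters $X_1,\dots,X_t$ in this order, and let $$T_P=\langle X_1,X_2,-X_1X_2,X_3,\dots,(-1)^{t+1}X_1\cdots X_t\rangle$$ be its pure trace form, the diagonal form with one coefficient $(-1)^{|S|+1}\prod_{i\in S}X_i$ for every nonempty $S\subseteq\{1,\dots,t\}$. Let $n\ge 1$ be an integer and write $n=2^k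 r$ with $k\ge 0$ and $r$ odd. Let $K'_n=K\big((2^k+1)\times\langle 1\rangle\perp(n-1)\times T_P\big)$ be the function field over $K$ of the form $\varphi'_n=(2^k+1)\times\langle 1\rangle\perp(n-1)\times T_P$, that is, the quotient field of $K[Y_1,\dots,Y_d]/(\varphi'_n(Y_1,\dots,Y_d))$ with $d=\dim\varphi'_n$. Let $A'_t(n)=A_t\otimes_K K'_n$, with the involution of $A_t$ extended $K'_n$-linearly. **Proposition 2.8.** The norm form $n_C^{A'_t(n)}$ is anisotropic over $K'_n$: if $x\in A'_t(n)$ and $n_C^{A'_t(n)}(x)=0$, then $x=0$. -/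

import Mathlib

universe u

open scoped TensorProduct

/-- A finite-dimensional unital (not necessarily associative) `K`-algebra together with a
scalar involution `conj`. -/
structure ScalarInvolutionAlgebra (K : Type u) [Field K] where
  carrier : Type u
  [ring : NonAssocRing carrier]
  [nontrivial : Nontrivial carrier]
  [module : Module K carrier]
  [isScalarTower : IsScalarTower K carrier carrier]
  [smulCommClass : SMulCommClass K carrier carrier]
  [finite : Module.Finite K carrier]
  conj : carrier →ₗ[K] carrier
  conj_mul : ∀ a b : carrier, conj (a * b) = conj b * conj a
  conj_conj : ∀ a : carrier, conj (conj a) = a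
  add_conj : ∀ a : carrier, ∃ c : K, a + conj a = c • (1 : carrier)
  mul_conj : ∀ a : carrier, ∃ c : K, a * conj a = c • (1 : carrier)

namespace ScalarInvolutionAlgebra

attribute [instance] ring nontrivial module isScalarTower smulCommClass finite

variable {K : Type u} [Field K]

theorem smul_one_injective (A : ScalarInvolutionAlgebra K) {c d : K}
    (h : c • (1 : A.carrier) = d • (1 : A.carrier)) : c = d :=
  smul_left_injective K (one_ne_zero : (1 : A.carrier) ≠ 0) h

/-- The scalar `n(a)` determined by `a * conj a = n(a) • 1`. -/
noncomputable def normFun (A : ScalarInvolutionAlgebra K) (a : A.carrier) : K :=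
  (A.mul_conj a).choose

theorem mul_conj_eq (A : ScalarInvolutionAlgebra K) (a : A.carrier) :
    a * A.conj a = A.normFun a • (1 : A.carrier) :=
  (A.mul_conj a).choose_spec

/-- The scalar `t(a)` determined by `a + conj a = t(a) • 1`. -/
noncomputable def traceFun (A : ScalarInvolutionAlgebra K) (a : A.carrier) : K :=
  (A.add_conj a).choose

theorem add_conj_eq (A : ScalarInvolutionAlgebra K) (a : A.carrier) :
    a + A.conj a = A.traceFun a • (1 : A.carrier) :=
  (A.add_conj a).choose_spec

theorem polar_eq (A : ScalarInvolutionAlgebra K) (a b : A.carrier) :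
    a * A.conj b + b * A.conj a = A.traceFun (a * A.conj b) • (1 : A.carrier) := by
  rw [← A.add_conj_eq, A.conj_mul, A.conj_conj]

/-- The norm form `n(a) = a * conj a` of an algebra with scalar involution, as a quadratic
form over the base field. -/
noncomputable def norm (A : ScalarInvolutionAlgebra K) : QuadraticForm K A.carrier where
  toFun := A.normFun
  toFun_smul c a := A.smul_one_injective (by
    rw [← A.mul_conj_eq, map_smul, smul_mul_smul_comm, A.mul_conj_eq, smul_smul, smul_eq_mul])
  exists_companion' :=
    ⟨LinearMap.mk₂ K (fun a b => A.traceFun (a * A.conj b))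
      (fun a a' b => A.smul_one_injective (by
        rw [← A.polar_eq, add_smul, ← A.polar_eq, ← A.polar_eq, map_add, add_mul, mul_add]
        abel))
      (fun c a b => A.smul_one_injective (by
        rw [← A.polar_eq, smul_eq_mul, mul_smul, ← A.polar_eq, map_smul, smul_mul_assoc,
          mul_smul_comm, smul_add]))
      (fun a b b' => A.smul_one_injective (by
        rw [← A.polar_eq, add_smul, ← A.polar_eq, ← A.polar_eq, map_add, add_mul, mul_add]
        abel))
      (fun c a b => A.smul_one_injective (by
        rw [← A.polar_eq, smul_eq_mul, mul_smul, ← A.polar_eq, map_smul, smul_mul_assoc,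
          mul_smul_comm, smul_add])),
      fun a b => A.smul_one_injective (by
        rw [LinearMap.mk₂_apply, add_smul, add_smul, ← A.polar_eq, ← A.mul_conj_eq,
          ← A.mul_conj_eq, ← A.mul_conj_eq, map_add, add_mul, mul_add, mul_add]
        abel)⟩

theorem norm_smul_one (A : ScalarInvolutionAlgebra K) (a : A.carrier) :
    A.norm a • (1 : A.carrier) = a * A.conj a :=
  (A.mul_conj_eq a).symm

/-- The field `K` itself, with the identity as scalar involution. -/
def ofField (K : Type u) [Field K] : ScalarInvolutionAlgebra K where
  carrier := K
  conj := LinearMap.id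
  conj_mul a b := mul_comm a b
  conj_conj _ := rfl
  add_conj a := ⟨a + a, by simp⟩
  mul_conj a := ⟨a * a, by simp⟩

/-- The underlying vector space `A ⊕ A` of the algebra `(A, γ)`. -/
@[ext] structure Double (A : ScalarInvolutionAlgebra K) (γ : K) where
  fst : A.carrier
  snd : A.carrier

namespace Double

variable {A : ScalarInvolutionAlgebra K} {γ : K}

def equivProd (A : ScalarInvolutionAlgebra K) (γ : K) :
    Double A γ ≃ A.carrier × A.carrier where
  toFun x := (x.fst, x.snd)
  invFun x := ⟨x.1, x.2⟩
  left_inv _ := rfl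
  right_inv _ := rfl

instance : AddCommGroup (Double A γ) := (equivProd A γ).addCommGroup

instance : Module K (Double A γ) := (equivProd A γ).module K

instance : Module.Finite K (Double A γ) :=
  Module.Finite.equiv ((equivProd A γ).linearEquiv K).symm

@[simp] theorem fst_zero : (0 : Double A γ).fst = 0 := rfl
@[simp] theorem snd_zero : (0 : Double A γ).snd = 0 := rfl
@[simp] theorem fst_add (x y : Double A γ) : (x + y).fst = x.fst + y.fst := rfl
@[simp] theorem snd_add (x y : Double A γ) : (x + y).snd = x.snd + y.snd := rfl
@[simp] theorem fst_smul (c : K) (x : Double A γ) : (c • x).fst = c • x.fst := rfl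
@[simp] theorem snd_smul (c : K) (x : Double A γ) : (c • x).snd = c • x.snd := rfl

instance : One (Double A γ) := ⟨⟨1, 0⟩⟩

/-- The Cayley–Dickson multiplication. -/
instance : Mul (Double A γ) :=
  ⟨fun a b =>
    ⟨a.fst * b.fst + γ • (A.conj b.snd * a.snd), a.snd * A.conj b.fst + b.snd * a.fst⟩⟩

@[simp] theorem fst_one : (1 : Double A γ).fst = 1 := rfl
@[simp] theorem snd_one : (1 : Double A γ).snd = 0 := rfl
@[simp] theorem fst_mul (a b : Double A γ) :
    (a * b).fst = a.fst * b.fst + γ • (A.conj b.snd * a.snd) := rfl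
@[simp] theorem snd_mul (a b : Double A γ) :
    (a * b).snd = a.snd * A.conj b.fst + b.snd * a.fst := rfl

end Double

@[simp] theorem conj_one (A : ScalarInvolutionAlgebra K) : A.conj 1 = 1 := by
  have h := A.conj_mul (A.conj 1) 1
  simpa [A.conj_conj] using h.symm

namespace Double

variable {A : ScalarInvolutionAlgebra K} {γ : K}

instance : NonAssocRing (Double A γ) where
  left_distrib a b c := by
    ext <;> simp [mul_add, add_mul, smul_add] <;> abel
  right_distrib a b c := by
    ext <;> simp [mul_add, add_mul, smul_add] <;> abel
  zero_mul a := by ext <;> simp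
  mul_zero a := by ext <;> simp
  one_mul a := by ext <;> simp
  mul_one a := by ext <;> simp

instance : Nontrivial (Double A γ) :=
  ⟨⟨0, 1, fun h => zero_ne_one (congrArg Double.fst h)⟩⟩

instance : IsScalarTower K (Double A γ) (Double A γ) :=
  ⟨fun c a b => by
    ext <;> simp [smul_add, smul_mul_assoc, mul_smul_comm, smul_comm c γ]⟩

instance : SMulCommClass K (Double A γ) (Double A γ) :=
  ⟨fun c a b => by
    ext <;> simp [smul_add, smul_mul_assoc, mul_smul_comm, smul_comm c γ]⟩

/-- The involution `(a₁, a₂) ↦ (conj a₁, -a₂)`. -/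
def conj (A : ScalarInvolutionAlgebra K) (γ : K) : Double A γ →ₗ[K] Double A γ where
  toFun a := ⟨A.conj a.fst, -a.snd⟩
  map_add' a b := by ext <;> simp [add_comm]
  map_smul' c a := by ext <;> simp

end Double

/-- The algebra `(A, γ)` obtained from `A` by the Cayley–Dickson process. -/
def double (A : ScalarInvolutionAlgebra K) (γ : K) : ScalarInvolutionAlgebra K where
  carrier := Double A γ
  conj := Double.conj A γ
  conj_mul a b := by
    ext <;> simp [Double.conj, A.conj_mul, A.conj_conj, add_comm]
  conj_conj a := by ext <;> simp [Double.conj, A.conj_conj]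
  add_conj a := ⟨A.traceFun a.fst, by ext <;> simp [Double.conj, A.add_conj_eq]⟩
  mul_conj a := ⟨A.normFun a.fst - γ * A.normFun (A.conj a.snd), by
    have h := A.mul_conj_eq (A.conj a.snd)
    rw [A.conj_conj] at h
    ext
    · rw [Double.fst_smul, Double.fst_one, sub_smul, mul_smul, ← h, ← A.mul_conj_eq]
      simp [Double.conj, sub_eq_add_neg]
    · simp [Double.conj, A.conj_conj]⟩

/-- The algebra `(α₁, …, α_t / K)` obtained from `K` by applying the Cayley–Dickson process
`t` times, with the parameters `α₁, …, α_t` in this order. -/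
def process : (t : ℕ) → (Fin t → K) → ScalarInvolutionAlgebra K
  | 0, _ => ofField K
  | t + 1, α => (process t fun i => α i.castSucc).double (α (Fin.last t))

section BaseChange

variable (A : ScalarInvolutionAlgebra K) (L : Type u) [Field L] [Algebra K L]

theorem conj_mul_baseChange (a b : L ⊗[K] A.carrier) :
    A.conj.baseChange L (a * b) = A.conj.baseChange L b * A.conj.baseChange L a := by
  induction a with
  | zero => simp
  | add a a' ha ha' => simp [add_mul, mul_add, ha, ha']
  | tmul l a =>
    induction b with
    | zero => simp
    | add b b' hb hb' => simp [add_mul, mul_add, hb, hb']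
    | tmul m b => simp [A.conj_mul, mul_comm]

theorem conj_conj_baseChange (a : L ⊗[K] A.carrier) :
    A.conj.baseChange L (A.conj.baseChange L a) = a := by
  induction a with
  | zero => simp
  | add a a' ha ha' => simp [ha, ha']
  | tmul l a => simp [A.conj_conj]

theorem exists_add_conj_baseChange (a : L ⊗[K] A.carrier) :
    ∃ c : L, a + A.conj.baseChange L a = c • (1 : L ⊗[K] A.carrier) := by
  induction a with
  | zero => exact ⟨0, by simp⟩
  | tmul l a =>
    refine ⟨l * algebraMap K L (A.traceFun a), ?_⟩
    rw [LinearMap.baseChange_tmul, ← TensorProduct.tmul_add, A.add_conj_eq,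
      TensorProduct.tmul_smul, Algebra.TensorProduct.one_def, TensorProduct.smul_tmul',
      TensorProduct.smul_tmul', smul_eq_mul, mul_one, Algebra.smul_def, mul_comm]
  | add a b ha hb =>
    obtain ⟨c, hc⟩ := ha
    obtain ⟨d, hd⟩ := hb
    refine ⟨c + d, ?_⟩
    rw [map_add, add_smul, ← hc, ← hd]
    abel

end BaseChange

/-- Extension of scalars `L ⊗ A`, with the involution `id ⊗ conj`. -/
noncomputable def baseChange (A : ScalarInvolutionAlgebra K) (L : Type u) [Field L]
    [Algebra K L] : ScalarInvolutionAlgebra L where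
  carrier := L ⊗[K] A.carrier
  nontrivial := inferInstance
  conj := A.conj.baseChange L
  conj_mul := conj_mul_baseChange A L
  conj_conj := conj_conj_baseChange A L
  add_conj a := exists_add_conj_baseChange A L a
  mul_conj a := by
    induction a with
    | zero => exact ⟨0, by simp⟩
    | tmul l a =>
      refine ⟨l * l * algebraMap K L (A.normFun a), ?_⟩
      rw [LinearMap.baseChange_tmul, Algebra.TensorProduct.tmul_mul_tmul, A.mul_conj_eq,
        TensorProduct.tmul_smul, Algebra.TensorProduct.one_def, TensorProduct.smul_tmul',
        TensorProduct.smul_tmul', smul_eq_mul, mul_one, Algebra.smul_def, mul_comm]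
    | add a b ha hb =>
      obtain ⟨c, hc⟩ := ha
      obtain ⟨d, hd⟩ := hb
      obtain ⟨e, he⟩ := exists_add_conj_baseChange A L (a * A.conj.baseChange L b)
      rw [conj_mul_baseChange, conj_conj_baseChange] at he
      refine ⟨c + d + e, ?_⟩
      rw [map_add, add_mul, mul_add, mul_add, add_smul, add_smul, ← hc, ← hd, ← he]
      abel

end ScalarInvolutionAlgebra

/-- The quadratic polynomial `∑ aᵢ Xᵢ²` of the diagonal form `⟨aᵢ⟩`, `i : ι`. -/
noncomputable def diagonalPolynomial {K : Type u} [Field K] {ι : Type} [Fintype ι] (a : ι → K) :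
    MvPolynomial ι K :=
  ∑ i, MvPolynomial.C (a i) * MvPolynomial.X i ^ 2

/-- The function field of the diagonal form `⟨aᵢ⟩`: the quotient field of
`K[Xᵢ : i ∈ ι] / (∑ aᵢ Xᵢ²)`. -/
abbrev DiagonalFunctionField {K : Type u} [Field K] {ι : Type} [Fintype ι] (a : ι → K) :
    Type u :=
  FractionRing (MvPolynomial ι K ⧸ Ideal.span {diagonalPolynomial a})

theorem isPrime_span_diagonalPolynomial {K : Type u} [Field K] {ι : Type} [Fintype ι]
    (a : ι → K) {i j : ι} (hij : j ≠ i) (hi : a i = 1) (hj : a j = 1)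
    (hK : ¬ IsSquare (-1 : K)) : (Ideal.span {diagonalPolynomial a}).IsPrime := by
  classical
  let e := (MvPolynomial.renameEquiv K (Equiv.optionSubtypeNe i).symm).trans
    (MvPolynomial.optionEquivLeft K {x // x ≠ i})
  let g : MvPolynomial {x // x ≠ i} K :=
    ∑ x : {x // x ≠ i}, MvPolynomial.C (a x) * MvPolynomial.X x ^ 2
  let p : Polynomial (MvPolynomial {x // x ≠ i} K) := Polynomial.X ^ 2 + Polynomial.C g
  have he : e (diagonalPolynomial a) = p := by
    have h1 : e (MvPolynomial.X i) = Polynomial.X := by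
      simp [e, MvPolynomial.optionEquivLeft_apply]
    have h2 : ∀ x : {x // x ≠ i},
        e (MvPolynomial.X x.1) = Polynomial.C (MvPolynomial.X x) := by
      intro x
      simp [e, MvPolynomial.optionEquivLeft_apply, Equiv.optionSubtypeNe_symm_apply, x.2]
    have h3 : ∀ c : K, e (MvPolynomial.C c) = Polynomial.C (MvPolynomial.C c) := by
      intro c
      simp [e, MvPolynomial.optionEquivLeft_apply]
    have h4 : diagonalPolynomial a = MvPolynomial.X i ^ 2 +
        ∑ x : {x // x ≠ i}, MvPolynomial.C (a x) * MvPolynomial.X x.1 ^ 2 := by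
      rw [diagonalPolynomial, Fintype.sum_eq_add_sum_subtype_ne _ i, hi, map_one, one_mul]
    rw [h4, map_add, map_pow, h1, map_sum]
    simp only [p, g, map_sum, map_mul, map_pow, h2, h3]
  have hd : p.natDegree = 2 := by
    simp only [p]
    compute_degree!
  have hm : p.Monic := by
    simp only [p]
    monicity!
  have hg : ∀ r : MvPolynomial {x // x ≠ i} K, r ^ 2 + g ≠ 0 := by
    intro r hr
    apply hK
    have h := congrArg
      (MvPolynomial.eval fun x : {x // x ≠ i} => if x = ⟨j, hij⟩ then (1 : K) else 0) hr
    simp only [g, map_add, map_pow, map_sum, map_mul, MvPolynomial.eval_C, MvPolynomial.eval_X,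
      ite_pow, one_pow, zero_pow two_ne_zero, mul_ite, mul_one, mul_zero, map_zero,
      Finset.sum_ite_eq', Finset.mem_univ, if_true, hj] at h
    exact ⟨_, by rw [← sq]; exact (eq_neg_of_add_eq_zero_left h).symm⟩
  have hirr : Irreducible p := by
    rw [hm.irreducible_iff_roots_eq_zero_of_degree_le_three (by omega) (by omega)]
    refine Multiset.eq_zero_of_forall_notMem fun r hr => hg r ?_
    simpa [p] using (Polynomial.mem_roots'.1 hr).2
  have hne : diagonalPolynomial a ≠ 0 := fun h => hirr.ne_zero (by rw [← he, h, map_zero])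
  rw [Ideal.span_singleton_prime hne]
  apply Irreducible.prime
  rw [← MulEquiv.irreducible_iff e.toMulEquiv]
  rw [← he] at hirr
  exact hirr

/-- The rational function field `K₀(X₁, …, X_t)`. -/
abbrev RationalField (K₀ : Type u) [Field K₀] (t : ℕ) : Type u :=
  FractionRing (MvPolynomial (Fin t) K₀)

/-- The indeterminates `X₁, …, X_t` of `K₀(X₁, …, X_t)`. -/
noncomputable def indeterminate (K₀ : Type u) [Field K₀] (t : ℕ) (i : Fin t) :
    RationalField K₀ t :=
  algebraMap (MvPolynomial (Fin t) K₀) (RationalField K₀ t) (MvPolynomial.X i)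

theorem not_isSquare_neg_one_rationalField (K₀ : Type u) [Field K₀] [IsFormallyReal K₀] (t : ℕ) :
    ¬ IsSquare (-1 : RationalField K₀ t) := by
  rintro ⟨x, hx⟩
  obtain ⟨y, hy⟩ := IsIntegrallyClosed.exists_algebraMap_eq_of_isIntegral_pow
    (R := MvPolynomial (Fin t) K₀) (x := x) two_pos (by
      rw [sq, ← hx]
      exact isIntegral_one.neg)
  have h : y * y = -1 := by
    apply IsFractionRing.injective (MvPolynomial (Fin t) K₀) (RationalField K₀ t)
    rw [map_mul, hy, map_neg, map_one, hx]
  have h' := congrArg (MvPolynomial.eval (0 : Fin t → K₀)) h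
  rw [map_mul, map_neg, map_one] at h'
  have h1 : IsSumSq (1 : K₀) := by simp
  exact one_ne_zero (IsFormallyReal.eq_zero_of_isSumSq_of_neg_isSumSq h1 (h' ▸ .mul_self _))

/-- The algebra `A_t` of Brown's construction over `K = K₀(X₁, …, X_t)`: the Cayley–Dickson
process with the parameters `X₁, …, X_t`. -/
noncomputable def brownAlgebra (K₀ : Type u) [Field K₀] (t : ℕ) :
    ScalarInvolutionAlgebra (RationalField K₀ t) :=
  ScalarInvolutionAlgebra.process t (indeterminate K₀ t)

/-- The coefficients of the pure trace form
`T_P = ⟨α₁, α₂, -α₁α₂, α₃, …, (-1)^(t+1) α₁⋯α_t⟩` of the algebra `(α₁, …, α_t / K)`: one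
coefficient `(-1)^(|S|+1) ∏_{i ∈ S} αᵢ` for each of the `2^t - 1` nonempty subsets `S` of
`{1, …, t}`. -/
def pureTraceCoeff {K : Type u} [Field K] {t : ℕ} (α : Fin t → K)
    (S : {S : Finset (Fin t) // S.Nonempty}) : K :=
  (-1) ^ (S.1.card + 1) * ∏ i ∈ S.1, α i

/-- The coefficients of the diagonal form `m × ⟨1⟩ ⊥ l × T_P` over `K₀(X₁, …, X_t)`, where `T_P`
is the pure trace form of `A_t`. -/
noncomputable def phiCoeff (K₀ : Type u) [Field K₀] (t m l : ℕ) :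
    Fin m ⊕ (Fin l × {S : Finset (Fin t) // S.Nonempty}) → RationalField K₀ t :=
  Sum.elim (fun _ => 1) fun p => pureTraceCoeff (indeterminate K₀ t) p.2

/-- The form `(2^k + 1) × ⟨1⟩ ⊥ (n - 1) × T_P` is irreducible, so that its function field is
a field. -/
instance isPrime_phi (K₀ : Type u) [Field K₀] [IsFormallyReal K₀] (t n k : ℕ) :
    (Ideal.span {diagonalPolynomial (phiCoeff K₀ t (2 ^ k + 1) (n - 1))}).IsPrime := by
  have hk : 0 < 2 ^ k := by positivity
  exact isPrime_span_diagonalPolynomial _ (i := Sum.inl ⟨0, by omega⟩) (j := Sum.inl ⟨1, by omega⟩)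
    (by simp) rfl rfl (not_isSquare_neg_one_rationalField K₀ t)

/-- The field `K'_n`, the function field of `(2^k + 1) × ⟨1⟩ ⊥ (n - 1) × T_P` over
`K₀(X₁, …, X_t)`. -/
abbrev PhiFunctionField (K₀ : Type u) [Field K₀] (t n k : ℕ) : Type u :=
  DiagonalFunctionField (phiCoeff K₀ t (2 ^ k + 1) (n - 1))

/-- The algebra `A'_t(n) = A_t ⊗_K K'_n`, with its scalar involution. -/
noncomputable def brownAlgebraPhi (K₀ : Type u) [Field K₀] [IsFormallyReal K₀] (t n k : ℕ) :
    ScalarInvolutionAlgebra (PhiFunctionField K₀ t n k) :=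
  (brownAlgebra K₀ t).baseChange (PhiFunctionField K₀ t n k)

/-!
The norm form of `A_t` is the Pfister form with the coefficients `∏_{i ∈ S} (-Xᵢ)`. Let `E` be an
algebraic closure of `K₀`. Over `E(X₁, …, X_t)` this form is still anisotropic, since its
coefficients are monomials whose exponents are pairwise distinct modulo `2`. On the other hand
`φ'_n` contains `⟨1, 1⟩`, a hyperbolic plane over `E`, so over `E(X₁, …, X_t)` the quadric
`φ'_n = 0` is rational. Hence `K'_n` embeds into a purely transcendental extension of
`E(X₁, …, X_t)`, and such an extension preserves anisotropy.
-/

open QuadraticMap (weightedSumSquares weightedSumSquares_apply)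

theorem equivalent_weightedSumSquares_comp {R ι κ : Type*} [CommRing R] [Fintype ι] [Fintype κ]
    (e : ι ≃ κ) (w : κ → R) :
    (weightedSumSquares R (w ∘ e)).Equivalent (weightedSumSquares R w) := by
  refine ⟨⟨LinearEquiv.funCongrLeft R R e.symm, fun x => ?_⟩⟩
  simp only [weightedSumSquares_apply]
  rw [← e.sum_comp]
  simp [LinearEquiv.funCongrLeft_apply, LinearMap.funLeft_apply]

theorem anisotropic_of_equivalent {R M N : Type*} [CommRing R] [AddCommGroup M] [Module R M]
    [AddCommGroup N] [Module R N] {Q : QuadraticForm R M} {Q' : QuadraticForm R N}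
    (h : Q.Equivalent Q') (hQ' : Q'.Anisotropic) : Q.Anisotropic := by
  obtain ⟨e⟩ := h
  exact fun x hx => (map_eq_zero_iff e.toLinearEquiv e.toLinearEquiv.injective).1
    (hQ' _ ((e.map_app x).trans hx))

namespace ScalarInvolutionAlgebra

variable {K : Type u} [Field K]

theorem norm_eq_of_mul_conj_eq (A : ScalarInvolutionAlgebra K) {a : A.carrier} {c : K}
    (h : a * A.conj a = c • (1 : A.carrier)) : A.norm a = c :=
  A.smul_one_injective (by rw [A.norm_smul_one, h])

theorem norm_conj (A : ScalarInvolutionAlgebra K) (a : A.carrier) :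
    A.norm (A.conj a) = A.norm a := by
  have h : A.conj a = A.traceFun a • (1 : A.carrier) - a := by
    rw [← A.add_conj_eq, add_sub_cancel_left]
  apply A.norm_eq_of_mul_conj_eq
  rw [A.conj_conj, A.norm_smul_one, h]
  simp only [sub_mul, mul_sub, smul_mul_assoc, mul_smul_comm, one_mul, mul_one]

theorem norm_double (A : ScalarInvolutionAlgebra K) (γ : K) (x : Double A γ) :
    (A.double γ).norm x = A.norm x.fst - γ * A.norm x.snd := by
  have h : A.conj x.snd * x.snd = A.norm x.snd • (1 : A.carrier) := by
    rw [← A.norm_conj, A.norm_smul_one, A.conj_conj]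
  apply (A.double γ).norm_eq_of_mul_conj_eq
  change x * Double.conj A γ x = (_ : K) • (1 : Double A γ)
  ext
  · rw [Double.fst_smul, Double.fst_one, sub_smul, mul_smul, ← h, A.norm_smul_one]
    simp [Double.conj, sub_eq_add_neg]
  · simp [Double.conj, A.conj_conj]

theorem norm_ofField (x : K) : (ofField K).norm x = x * x :=
  (ofField K).norm_eq_of_mul_conj_eq (mul_one (x * x)).symm

theorem norm_baseChange_one_tmul (A : ScalarInvolutionAlgebra K) (L : Type u) [Field L]
    [Algebra K L] (a : A.carrier) :
    (A.baseChange L).norm (1 ⊗ₜ[K] a : L ⊗[K] A.carrier) = algebraMap K L (A.norm a) := by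
  have h : (1 ⊗ₜ[K] a : L ⊗[K] A.carrier) * A.conj.baseChange L (1 ⊗ₜ[K] a) =
      algebraMap K L (A.norm a) • (1 : L ⊗[K] A.carrier) := by
    rw [LinearMap.baseChange_tmul, Algebra.TensorProduct.tmul_mul_tmul, ← A.norm_smul_one,
      TensorProduct.tmul_smul, Algebra.TensorProduct.one_def, mul_one, algebraMap_smul]
  exact (A.baseChange L).norm_eq_of_mul_conj_eq h

theorem norm_baseChange_equivalent (A : ScalarInvolutionAlgebra K) {ι : Type*} [Fintype ι]
    {c : ι → K} (h : A.norm.Equivalent (weightedSumSquares K c)) (L : Type u) [Field L]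
    [Algebra K L] :
    (A.baseChange L).norm.Equivalent (weightedSumSquares L (algebraMap K L ∘ c)) := by
  classical
  obtain ⟨e⟩ := h
  let e' : L ⊗[K] A.carrier ≃ₗ[L] (ι → L) :=
    (e.toLinearEquiv.baseChange K L).trans (TensorProduct.piScalarRight K L L ι)
  have he' : (weightedSumSquares L (algebraMap K L ∘ c)).comp e'.toLinearMap =
      (A.baseChange L).norm := by
    refine baseChange_ext fun a => ?_
    refine Eq.trans ?_ (A.norm_baseChange_one_tmul L a).symm
    rw [← e.map_app, weightedSumSquares_apply]
    simp [e', weightedSumSquares_apply, Algebra.smul_def]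
  exact ⟨⟨e', fun x => congrFun (congrArg DFunLike.coe he') x⟩⟩

theorem norm_double_equivalent (A : ScalarInvolutionAlgebra K) {ι : Type*} [Fintype ι]
    {c : ι → K} (h : A.norm.Equivalent (weightedSumSquares K c)) (γ : K) :
    (A.double γ).norm.Equivalent (weightedSumSquares K (Sum.elim c fun i => -γ * c i)) := by
  obtain ⟨e⟩ := h
  refine ⟨⟨((Double.equivProd A γ).linearEquiv K).trans
    ((e.toLinearEquiv.prodCongr e.toLinearEquiv).trans
      (LinearEquiv.sumArrowLequivProdArrow ι ι K K).symm), fun x => ?_⟩⟩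
  refine Eq.trans ?_ (norm_double A γ x).symm
  rw [← e.map_app x.fst, ← e.map_app x.snd, sub_eq_add_neg, ← neg_mul]
  simp only [weightedSumSquares_apply, Fintype.sum_sum_type, Finset.mul_sum, Sum.elim_inl,
    Sum.elim_inr, smul_eq_mul, mul_assoc]
  rfl

/-- The coefficient of the norm form of `(α₁, …, α_t / K)` at the basis element indexed by the set
`S` of the doubling steps that contribute their second component to it. -/
def normCoeff {R : Type*} [CommRing R] {t : ℕ} (α : Fin t → R) (S : Finset (Fin t)) : R :=
  ∏ i ∈ S, -α i

theorem comp_normCoeff {R S : Type*} [CommRing R] [CommRing S] (f : R →+* S) {t : ℕ}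
    (α : Fin t → R) : f ∘ normCoeff α = normCoeff (f ∘ α) := by
  ext
  simp only [normCoeff, Function.comp_apply, map_prod, map_neg]

theorem exists_equiv_normCoeff_comp_eq {t : ℕ} (α : Fin (t + 1) → K) :
    ∃ e : Finset (Fin t) ⊕ Finset (Fin t) ≃ Finset (Fin (t + 1)), normCoeff α ∘ e =
      Sum.elim (normCoeff fun i => α i.castSucc)
        fun S => -α (Fin.last t) * normCoeff (fun i => α i.castSucc) S := by
  have hlast (S : Finset (Fin t)) : Fin.last t ∉ S.map Fin.castSuccEmb := by simp
  let f : Finset (Fin t) ⊕ Finset (Fin t) → Finset (Fin (t + 1)) :=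
    Sum.elim (fun S => S.map Fin.castSuccEmb) fun S => (S.map Fin.castSuccEmb).cons _ (hlast S)
  have hf : f.Injective := by
    refine .sumElim (Finset.map_injective _) (fun S T h => ?_) fun S T h => ?_
    · refine Finset.map_injective Fin.castSuccEmb ?_
      rw [← Finset.erase_cons (hlast S), ← Finset.erase_cons (hlast T)]
      exact congrArg (Finset.erase · _) h
    · exact hlast S (h ▸ Finset.mem_cons_self _ _)
  have hcard : Fintype.card (Finset (Fin t) ⊕ Finset (Fin t)) =
      Fintype.card (Finset (Fin (t + 1))) := by
    simp [pow_succ, mul_two]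
  refine ⟨.ofBijective f ((Fintype.bijective_iff_injective_and_card f).2 ⟨hf, hcard⟩), ?_⟩
  ext (S | S) <;> simp [f, normCoeff]

theorem norm_process_equivalent {t : ℕ} (α : Fin t → K) :
    (process t α).norm.Equivalent (weightedSumSquares K (normCoeff α)) := by
  induction t with
  | zero =>
    refine ⟨⟨(LinearEquiv.funUnique (Finset (Fin 0)) K K).symm, fun x => ?_⟩⟩
    refine Eq.trans ?_ (norm_ofField (K := K) x).symm
    rw [weightedSumSquares_apply, Fintype.sum_unique]
    exact one_smul K (x * x)
  | succ t ih =>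
    obtain ⟨e, he⟩ := exists_equiv_normCoeff_comp_eq α
    refine (norm_double_equivalent _ (ih fun i => α i.castSucc) (α (Fin.last t))).trans ?_
    rw [← he]
    exact equivalent_weightedSumSquares_comp e _

end ScalarInvolutionAlgebra

section Anisotropy

variable {R ι : Type*} [CommRing R] [Fintype ι]

theorem anisotropic_of_forall_ringHom {S κ : Type*} [CommRing S] (f : κ → R →+* S)
    (hf : ∀ x, (∀ k, f k x = 0) → x = 0) {w : ι → R}
    (h : ∀ k, (weightedSumSquares S (f k ∘ w)).Anisotropic) :
    (weightedSumSquares R w).Anisotropic := by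
  refine fun x hx => funext fun i => hf _ fun k => ?_
  refine congrFun (h k (f k ∘ x) ?_) i
  simpa [weightedSumSquares_apply] using congrArg (f k) hx

theorem anisotropic_of_injective {S : Type*} [CommRing S] {f : R →+* S}
    (hf : Function.Injective f) {w : ι → R}
    (h : (weightedSumSquares S (f ∘ w)).Anisotropic) : (weightedSumSquares R w).Anisotropic :=
  anisotropic_of_forall_ringHom (fun _ : Unit => f)
    (fun _ hx => (map_eq_zero_iff f hf).1 (hx ())) fun _ => h

theorem anisotropic_fractionRing [IsDomain R] (F : Type*) [Field F] [Algebra R F]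
    [IsFractionRing R F] {w : ι → R} (h : (weightedSumSquares R w).Anisotropic) :
    (weightedSumSquares F (algebraMap R F ∘ w)).Anisotropic := by
  intro x hx
  obtain ⟨⟨d, hd⟩, hdx⟩ := IsLocalization.exist_integer_multiples_of_finite (nonZeroDivisors R) x
  choose y hy using hdx
  have hd0 : algebraMap R F d ≠ 0 := by simpa using nonZeroDivisors.ne_zero hd
  have hy0 : y = 0 := by
    refine h y (IsFractionRing.injective R F ?_)
    have hyx : algebraMap R F ∘ y = algebraMap R F d • x :=
      funext fun i => (hy i).trans (Algebra.smul_def d (x i))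
    have hval : weightedSumSquares F (algebraMap R F ∘ w) (algebraMap R F ∘ y) = 0 := by
      rw [hyx, QuadraticMap.map_smul, hx, smul_zero]
    simpa [weightedSumSquares_apply] using hval
  ext i
  have hi : algebraMap R F d * x i = 0 := by
    rw [← Algebra.smul_def, ← hy i, hy0, Pi.zero_apply, map_zero]
  exact (mul_eq_zero.1 hi).resolve_left hd0

theorem anisotropic_mvPolynomial [IsDomain R] [Infinite R] (σ : Type*) {w : ι → R}
    (h : (weightedSumSquares R w).Anisotropic) :
    (weightedSumSquares (MvPolynomial σ R)
      ((MvPolynomial.C : R →+* MvPolynomial σ R) ∘ w)).Anisotropic := by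
  refine anisotropic_of_forall_ringHom (fun x : σ → R => MvPolynomial.eval x)
    (fun p hp => MvPolynomial.funext fun x => by rw [hp, map_zero]) fun x => ?_
  convert h
  ext i
  simp

theorem anisotropic_fractionRing_mvPolynomial {F L σ : Type*} [Field F] [Infinite F] [Field L]
    [Algebra F L] [Algebra (MvPolynomial σ F) L] [IsScalarTower F (MvPolynomial σ F) L]
    [IsFractionRing (MvPolynomial σ F) L] {w : ι → F} (h : (weightedSumSquares F w).Anisotropic) :
    (weightedSumSquares L (algebraMap F L ∘ w)).Anisotropic := by
  rw [IsScalarTower.algebraMap_eq F (MvPolynomial σ F) L]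
  exact anisotropic_fractionRing L (anisotropic_mvPolynomial σ h)

theorem eq_zero_of_sum_eq_zero_of_degree_injOn {σ : Type*} (m : MonomialOrder σ)
    {f : ι → MvPolynomial σ R} (hf : Set.InjOn (fun i => m.degree (f i)) {i | f i ≠ 0})
    (h : ∑ i, f i = 0) : f = 0 := by
  classical
  by_contra hne
  obtain ⟨i, hi⟩ := Function.ne_iff.1 hne
  obtain ⟨j, hj, hmax⟩ := Finset.exists_max_image (Finset.univ.filter fun j => f j ≠ 0)
    (fun j => m.toSyn (m.degree (f j))) ⟨i, by simpa using hi⟩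
  have hj0 : f j ≠ 0 := by simpa using hj
  have hcoeff := congrArg (MvPolynomial.coeff (m.degree (f j))) h
  rw [MvPolynomial.coeff_sum, MvPolynomial.coeff_zero, Finset.sum_eq_single_of_mem j
    (Finset.mem_univ j)] at hcoeff
  · exact m.coeff_degree_ne_zero_iff.2 hj0 hcoeff
  · intro k _ hkj
    by_cases hk : f k = 0
    · rw [hk, MvPolynomial.coeff_zero]
    · exact m.coeff_eq_zero_of_lt ((hmax k (by simpa using hk)).lt_of_ne fun he =>
        hkj (hf hk hj0 (m.toSyn.injective he)))

theorem anisotropic_of_degree_mod_two_injective {σ : Type*} [IsDomain R] (m : MonomialOrder σ)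
    {w : ι → MvPolynomial σ R} (hw : ∀ i, w i ≠ 0)
    (hm : Function.Injective fun i x => m.degree (w i) x % 2) :
    (weightedSumSquares (MvPolynomial σ R) w).Anisotropic := by
  intro p hp
  rw [weightedSumSquares_apply] at hp
  have hdeg {i : ι} (hi : w i • (p i * p i) ≠ 0) (x : σ) :
      m.degree (w i • (p i * p i)) x % 2 = m.degree (w i) x % 2 := by
    rw [smul_eq_mul, m.degree_mul' hi, ← pow_two, m.degree_pow]
    exact Nat.add_mul_mod_self_left _ _ _
  have hzero := eq_zero_of_sum_eq_zero_of_degree_injOn m (fun i hi j hj hij => hm ?_) hp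
  · ext1 i
    simpa [hw i] using congrFun hzero i
  · ext1 x
    exact (hdeg hi x).symm.trans ((congrArg (fun d => d x % 2) hij).trans (hdeg hj x))

end Anisotropy

section NormForm

open ScalarInvolutionAlgebra

variable (E : Type u) [Field E] (t : ℕ)

theorem anisotropic_normCoeff_X :
    (weightedSumSquares (MvPolynomial (Fin t) E)
      (normCoeff (R := MvPolynomial (Fin t) E) MvPolynomial.X)).Anisotropic := by
  classical
  have hX (i : Fin t) : -MvPolynomial.X i ≠ (0 : MvPolynomial (Fin t) E) :=
    neg_ne_zero.2 (MvPolynomial.X_ne_zero i)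
  refine anisotropic_of_degree_mod_two_injective .lex
    (fun S => Finset.prod_ne_zero_iff.2 fun i _ => hX i) fun S T h => ?_
  have hdeg (S : Finset (Fin t)) (x : Fin t) : MonomialOrder.lex.degree
      (normCoeff (R := MvPolynomial (Fin t) E) MvPolynomial.X S) x = if x ∈ S then 1 else 0 := by
    rw [normCoeff, MonomialOrder.degree_prod fun i _ => hX i]
    simp [MonomialOrder.degree_neg, MonomialOrder.degree_X, Finsupp.single_apply]
  ext x
  have hx := congrFun h x
  simp only [hdeg] at hx
  by_cases hS : x ∈ S <;> by_cases hT : x ∈ T <;> simp_all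

theorem anisotropic_normCoeff_indeterminate :
    (weightedSumSquares (RationalField E t) (normCoeff (indeterminate E t))).Anisotropic := by
  have h := comp_normCoeff (algebraMap _ (RationalField E t)) (MvPolynomial.X (R := E) (σ := Fin t))
  exact h ▸ anisotropic_fractionRing (RationalField E t) (anisotropic_normCoeff_X E t)

end NormForm

section FunctionField

open Algebra

theorem algebraicIndepOn_update {F L ι : Type*} [Field F] [Field L] [Algebra F L] [DecidableEq ι]
    {Y : ι → L} (hY : AlgebraicIndependent F Y) {i j : ι} (hij : i ≠ j) {s : L}
    (hs : IsAlgebraic (adjoin F (insert s (Y '' {i, j}ᶜ))) (Y i)) :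
    AlgebraicIndepOn F (Function.update Y j s) {i}ᶜ := by
  have hupd : Set.EqOn (Function.update Y j s) Y {i, j}ᶜ := fun x hx =>
    Function.update_of_ne (fun h => hx (by simp [h])) _ _
  have hset : ({i}ᶜ : Set ι) = insert j {i, j}ᶜ := by
    ext x
    by_cases hx : x = j <;> simp [hx, hij.symm]
  have htrans : Transcendental (adjoin F (Y '' {i, j}ᶜ)) s := fun halg =>
    hY.transcendental_adjoin (s := {i, j}ᶜ) (i := i) (by simp) <|
      IsAlgebraic.adjoin_of_forall_isAlgebraic (s := insert s (Y '' {i, j}ᶜ))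
        (fun x hx => (hx.1.resolve_right hx.2) ▸ halg) hs
  rw [hset]
  refine AlgebraicIndepOn.insert ?_ ?_
  · have h : AlgebraicIndepOn F Y {i, j}ᶜ := hY.comp _ Subtype.val_injective
    rwa [AlgebraicIndepOn, ← funext fun x : ({i, j}ᶜ : Set ι) => hupd x.2] at h
  · rw [Set.image_congr hupd, Function.update_self]
    exact htrans

variable {K : Type u} [Field K] {ι : Type} [Fintype ι] {a : ι → K} {i : ι}

theorem diagonalPolynomial_eq_add [DecidableEq ι] (a : ι → K) (i : ι) :
    diagonalPolynomial a = MvPolynomial.C (a i) * MvPolynomial.X i ^ 2 +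
      MvPolynomial.rename (↑) (diagonalPolynomial fun x : {x // x ≠ i} => a x) := by
  rw [diagonalPolynomial, Fintype.sum_eq_add_sum_subtype_ne _ i, diagonalPolynomial]
  simp only [map_sum, map_mul, map_pow, MvPolynomial.rename_C, MvPolynomial.rename_X]

theorem isIntegral_mk_comp_rename (hi : a i ≠ 0) :
    ((Ideal.Quotient.mk (Ideal.span {diagonalPolynomial a})).comp
      (MvPolynomial.rename (R := K) ((↑) : {x // x ≠ i} → ι)).toRingHom).IsIntegral := by
  classical
  set f := (Ideal.Quotient.mk (Ideal.span {diagonalPolynomial a})).comp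
    (MvPolynomial.rename (R := K) ((↑) : {x // x ≠ i} → ι)).toRingHom
  have hrename (p : MvPolynomial {x // x ≠ i} K) :
      f.IsIntegralElem (Ideal.Quotient.mk _ (MvPolynomial.rename (↑) p)) :=
    f.isIntegralElem_map
  have hX : f.IsIntegralElem (Ideal.Quotient.mk _ (MvPolynomial.X i)) := by
    let _ := f.toAlgebra
    let g := -(MvPolynomial.C (a i)⁻¹ * diagonalPolynomial fun x : {x // x ≠ i} => a x)
    have hsq : Ideal.Quotient.mk (Ideal.span {diagonalPolynomial a}) (MvPolynomial.X i ^ 2) =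
        Ideal.Quotient.mk _ (MvPolynomial.rename (↑) g) := by
      refine Ideal.Quotient.eq.2 (Ideal.mem_span_singleton'.2 ⟨MvPolynomial.C (a i)⁻¹, ?_⟩)
      have hC : (MvPolynomial.C (a i)⁻¹ * MvPolynomial.C (a i) : MvPolynomial ι K) = 1 := by
        rw [← map_mul, inv_mul_cancel₀ hi, map_one]
      rw [diagonalPolynomial_eq_add a i, map_neg, map_mul, MvPolynomial.rename_C]
      linear_combination MvPolynomial.X i ^ 2 * hC
    refine IsIntegral.of_pow two_pos ?_
    rw [← map_pow, hsq]
    exact hrename g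
  intro q
  obtain ⟨p, rfl⟩ := Ideal.Quotient.mk_surjective q
  induction p using MvPolynomial.induction_on with
  | C c => simpa only [MvPolynomial.rename_C] using hrename (MvPolynomial.C c)
  | add p q hp hq =>
    rw [map_add]
    exact RingHom.IsIntegralElem.add f hp hq
  | mul_X p x hp =>
    rw [map_mul]
    refine RingHom.IsIntegralElem.mul f hp ?_
    by_cases hx : x = i
    · rwa [hx]
    · simpa only [MvPolynomial.rename_X] using hrename (MvPolynomial.X ⟨x, hx⟩)

theorem injective_of_comp_rename_injective [(Ideal.span {diagonalPolynomial a}).IsPrime]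
    (hi : a i ≠ 0) {S : Type*} [CommRing S]
    {f : MvPolynomial ι K ⧸ Ideal.span {diagonalPolynomial a} →+* S}
    (hf : Function.Injective ((f.comp (Ideal.Quotient.mk _)).comp
      (MvPolynomial.rename ((↑) : {x // x ≠ i} → ι)).toRingHom)) :
    Function.Injective f := by
  let g := (Ideal.Quotient.mk (Ideal.span {diagonalPolynomial a})).comp
    (MvPolynomial.rename (R := K) ((↑) : {x // x ≠ i} → ι)).toRingHom
  let _ := g.toAlgebra
  have : Algebra.IsIntegral (MvPolynomial {x // x ≠ i} K)
      (MvPolynomial ι K ⧸ Ideal.span {diagonalPolynomial a}) :=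
    ⟨isIntegral_mk_comp_rename hi⟩
  refine (RingHom.injective_iff_ker_eq_bot f).2 (Ideal.eq_bot_of_comap_eq_bot
    (R := MvPolynomial {x // x ≠ i} K) ?_)
  rw [RingHom.comap_ker]
  exact (RingHom.injective_iff_ker_eq_bot _).1 hf

theorem exists_ringHom_diagonalFunctionField [(Ideal.span {diagonalPolynomial a}).IsPrime]
    (hi : a i ≠ 0) {F L : Type*} [Field F] [Field L] [Algebra F L] (ψ : K →+* F) {y : ι → L}
    (hy : AlgebraicIndepOn F y {i}ᶜ) (h0 : ∑ x, algebraMap F L (ψ (a x)) * y x ^ 2 = 0) :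
    ∃ Ψ : DiagonalFunctionField a →+* L,
      Ψ.comp (algebraMap K (DiagonalFunctionField a)) = (algebraMap F L).comp ψ := by
  let f : MvPolynomial ι K →+* L := MvPolynomial.eval₂Hom ((algebraMap F L).comp ψ) y
  have hf : ∀ p ∈ Ideal.span {diagonalPolynomial a}, f p = 0 := by
    have hdiag : f (diagonalPolynomial a) = 0 := by
      simpa [f, diagonalPolynomial] using h0
    intro p hp
    obtain ⟨p, rfl⟩ := Ideal.mem_span_singleton'.1 hp
    rw [map_mul, hdiag, mul_zero]
  have hinj : Function.Injective
      (f.comp (MvPolynomial.rename ((↑) : {x // x ≠ i} → ι)).toRingHom) := by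
    have haeval : Function.Injective (MvPolynomial.aeval (R := F) fun x : {x // x ≠ i} => y x) := hy
    have hcomp : f.comp (MvPolynomial.rename ((↑) : {x // x ≠ i} → ι)).toRingHom =
        (MvPolynomial.aeval fun x : {x // x ≠ i} => y x).toRingHom.comp (MvPolynomial.map ψ) := by
      ext <;> simp [f]
    rw [hcomp]
    exact haeval.comp (MvPolynomial.map_injective ψ ψ.injective)
  refine ⟨IsFractionRing.lift (injective_of_comp_rename_injective hi
    (f := Ideal.Quotient.lift _ f hf) hinj), RingHom.ext fun c => ?_⟩
  rw [RingHom.comp_apply, IsScalarTower.algebraMap_apply K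
    (MvPolynomial ι K ⧸ Ideal.span {diagonalPolynomial a}), IsFractionRing.lift_algebraMap]
  exact MvPolynomial.eval₂Hom_C _ _ c

theorem isAlgebraic_of_sq_sub_mul_add_eq_zero {R A : Type*} [CommRing R] [CommRing A]
    [Nontrivial A] [Algebra R A] (B : Subalgebra R A) {b c x : A} (hb : b ∈ B) (hc : c ∈ B)
    (h : x ^ 2 - b * x + c = 0) : IsAlgebraic B x := by
  let P : Polynomial B := .X ^ 2 - .C ⟨b, hb⟩ * .X + .C ⟨c, hc⟩
  have hP : P.Monic := by
    simp only [P]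
    monicity!
  refine IsIntegral.isAlgebraic ⟨P, hP, ?_⟩
  simpa [P] using h

theorem exists_conic_point {L : Type*} [Field L] (h2 : (2 : L) ≠ 0) {v x : L} (hv : v ≠ 0)
    (hx : x ≠ 0) (q : L) :
    ∃ p s, p ^ 2 - v ^ 2 * s ^ 2 = -q ∧ x ^ 2 - 2 * v * s * x + q = 0 := by
  -- The point of the conic `p² - v² s² = -q` at which `p + v s` takes the value `x`.
  refine ⟨(x - q / x) / 2, (x + q / x) / (2 * v), ?_, ?_⟩ <;>
  · field_simp
    ring

theorem exists_isotropic_algebraicIndepOn {F L : Type*} [Field F] [Field L] [Algebra F L]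
    (h2 : (2 : F) ≠ 0) {c : ι → F} {j : ι} (hij : i ≠ j) (hi : c i ≠ 0) {v : F} (hv : v ≠ 0)
    (hj : c j = -(v ^ 2 * c i)) {Y : ι → L} (hY : AlgebraicIndependent F Y) :
    ∃ y : ι → L, AlgebraicIndepOn F y {i}ᶜ ∧ ∑ x, algebraMap F L (c x) * y x ^ 2 = 0 := by
  classical
  have hmap {d : F} (hd : d ≠ 0) : algebraMap F L d ≠ 0 := (map_ne_zero _).2 hd
  have h2L : (2 : L) ≠ 0 := by simpa only [map_ofNat] using hmap h2
  obtain ⟨q, hq⟩ : ∃ q, q = ∑ x ∈ {i, j}ᶜ, algebraMap F L ((c i)⁻¹ * c x) * Y x ^ 2 := ⟨_, rfl⟩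
  obtain ⟨p, s, hps, hsY⟩ := exists_conic_point h2L (hmap hv) (hY.ne_zero i) q
  have halg : IsAlgebraic (adjoin F (insert s (Y '' {i, j}ᶜ))) (Y i) := by
    let B := adjoin F (insert s (Y '' {i, j}ᶜ))
    have hsB : s ∈ B := subset_adjoin (Set.mem_insert _ _)
    have hqB : q ∈ B := by
      rw [hq]
      refine B.sum_mem fun x hx => B.mul_mem (B.algebraMap_mem _) (B.pow_mem ?_ 2)
      exact subset_adjoin (.inr ⟨x, by simpa using hx, rfl⟩)
    have hbB : 2 * algebraMap F L v * s ∈ B :=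
      B.mul_mem (B.mul_mem (ofNat_mem B 2) (B.algebraMap_mem v)) hsB
    exact isAlgebraic_of_sq_sub_mul_add_eq_zero B hbB hqB hsY
  refine ⟨Function.update (Function.update Y j s) i p, ?_, ?_⟩
  · have h := algebraicIndepOn_update hY hij halg
    rwa [AlgebraicIndepOn, ← funext fun x : ({i}ᶜ : Set ι) =>
      Function.update_of_ne x.2 p _] at h
  · have hcompl : ∑ x ∈ {i, j}ᶜ, algebraMap F L (c x) *
        Function.update (Function.update Y j s) i p x ^ 2 = algebraMap F L (c i) * q := by
      rw [hq, Finset.mul_sum]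
      refine Finset.sum_congr rfl fun x hx => ?_
      have hx : x ≠ i ∧ x ≠ j := by simpa using hx
      rw [Function.update_of_ne hx.1, Function.update_of_ne hx.2, ← mul_assoc, ← map_mul,
        mul_inv_cancel_left₀ hi]
    rw [← Finset.sum_add_sum_compl {i, j}, Finset.sum_pair hij, hcompl, Function.update_self,
      Function.update_of_ne hij.symm, Function.update_self, hj, map_neg, map_mul, map_pow]
    linear_combination algebraMap F L (c i) * hps

theorem anisotropic_diagonalFunctionField [(Ideal.span {diagonalPolynomial a}).IsPrime] {F : Type*}
    [Field F] [Infinite F] (h2 : (2 : F) ≠ 0) (ψ : K →+* F) {j : ι} (hij : i ≠ j) (hi : a i ≠ 0)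
    {v : F} (hv : v ≠ 0) (hj : ψ (a j) = -(v ^ 2 * ψ (a i))) {κ : Type*} [Fintype κ]
    {c : κ → K} (hc : (weightedSumSquares F (ψ ∘ c)).Anisotropic) :
    (weightedSumSquares (DiagonalFunctionField a)
      (algebraMap K (DiagonalFunctionField a) ∘ c)).Anisotropic := by
  have hX : AlgebraicIndependent F fun x =>
      algebraMap (MvPolynomial ι F) (FractionRing (MvPolynomial ι F)) (MvPolynomial.X x) :=
    (MvPolynomial.algebraicIndependent_X ι F).map'
      (f := IsScalarTower.toAlgHom F _ (FractionRing (MvPolynomial ι F)))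
      (IsFractionRing.injective _ _)
  obtain ⟨y, hy, hy0⟩ := exists_isotropic_algebraicIndepOn h2 (c := ψ ∘ a) hij
    ((map_ne_zero ψ).2 hi) hv hj hX
  obtain ⟨Ψ, hΨ⟩ := exists_ringHom_diagonalFunctionField hi ψ hy hy0
  have hΨc : Ψ ∘ algebraMap K (DiagonalFunctionField a) ∘ c =
      algebraMap F (FractionRing (MvPolynomial ι F)) ∘ ψ ∘ c :=
    funext fun k => DFunLike.congr_fun hΨ (c k)
  refine anisotropic_of_injective Ψ.injective ?_
  rw [hΨc]
  exact anisotropic_fractionRing_mvPolynomial (σ := ι) hc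

end FunctionField

open ScalarInvolutionAlgebra

theorem exists_ringHom_rationalField {K₀ E : Type u} [Field K₀] [Field E] (φ : K₀ →+* E) (t : ℕ) :
    ∃ ψ : RationalField K₀ t →+* RationalField E t,
      ψ ∘ indeterminate K₀ t = indeterminate E t ∧
        ∀ c, ψ (algebraMap K₀ _ c) = algebraMap E _ (φ c) := by
  let f : MvPolynomial (Fin t) K₀ →+* RationalField E t :=
    (algebraMap (MvPolynomial (Fin t) E) (RationalField E t)).comp (MvPolynomial.map φ)
  have hf : Function.Injective f :=
    (IsFractionRing.injective _ _).comp (MvPolynomial.map_injective φ φ.injective)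
  refine ⟨IsFractionRing.lift hf, funext fun i => ?_, fun c => ?_⟩
  · rw [Function.comp_apply, indeterminate, IsFractionRing.lift_algebraMap]
    simp [f, indeterminate]
  · rw [IsScalarTower.algebraMap_apply K₀ (MvPolynomial (Fin t) K₀),
      IsFractionRing.lift_algebraMap]
    simp [f, IsScalarTower.algebraMap_apply E (MvPolynomial (Fin t) E)]

theorem two_ne_zero_of_isFormallyReal {R : Type*} [CommRing R] [Nontrivial R] [IsFormallyReal R] :
    (2 : R) ≠ 0 := fun h =>
  one_ne_zero (IsFormallyReal.eq_zero_of_add_right .one .one (one_add_one_eq_two.trans h))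

theorem proposition2p8_general {K₀ : Type u} [Field K₀] (h2 : (2 : K₀) ≠ 0) (t : ℕ) {ι : Type}
    [Fintype ι] (a : ι → RationalField K₀ t) [(Ideal.span {diagonalPolynomial a}).IsPrime]
    {i j : ι} (hij : i ≠ j) {b c : K₀} (hb : b ≠ 0) (hc : c ≠ 0)
    (hi : a i = algebraMap K₀ _ b) (hj : a j = algebraMap K₀ _ c) :
    ((brownAlgebra K₀ t).baseChange (DiagonalFunctionField a)).norm.Anisotropic := by
  let E := AlgebraicClosure K₀
  obtain ⟨ψ, hX, hψ⟩ := exists_ringHom_rationalField (algebraMap K₀ E) t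
  have : Infinite (RationalField E t) := .of_injective _ (algebraMap E _).injective
  obtain ⟨v, hv⟩ := IsAlgClosed.exists_pow_nat_eq (-algebraMap K₀ E (c / b)) two_pos
  have hv0 : v ≠ 0 := ne_zero_pow two_ne_zero <| by
    rw [hv]
    exact neg_ne_zero.2 ((map_ne_zero _).2 (div_ne_zero hc hb))
  have hψj : ψ (a j) = -(algebraMap E _ v ^ 2 * ψ (a i)) := by
    rw [hi, hj, hψ, hψ, ← map_pow, ← map_mul, ← map_neg, hv, neg_mul, neg_neg, ← map_mul,
      div_mul_cancel₀ c hb]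
  have h2E : (2 : RationalField E t) ≠ 0 := by
    simpa only [map_ofNat] using (map_ne_zero (ψ.comp (algebraMap K₀ _))).2 h2
  have hnorm : (weightedSumSquares (RationalField E t)
      (ψ ∘ normCoeff (indeterminate K₀ t))).Anisotropic := by
    rw [comp_normCoeff, hX]
    exact anisotropic_normCoeff_indeterminate E t
  exact anisotropic_of_equivalent
    (norm_baseChange_equivalent _ (norm_process_equivalent (indeterminate K₀ t)) _)
    (anisotropic_diagonalFunctionField h2E ψ hij (hi ▸ (map_ne_zero _).2 hb)
      ((map_ne_zero _).2 hv0) hψj hnorm)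

theorem proposition2p8 {K₀ : Type u} [Field K₀] [IsFormallyReal K₀] (t n k r : ℕ) (ht : 1 ≤ t)
    (hr : Odd r) (hn : n = 2 ^ k * r) :
    (brownAlgebraPhi K₀ t n k).norm.Anisotropic := by
  have h : (0 : Fin (2 ^ k + 1)) ≠ Fin.last _ := (Fin.last_pos' (n := 2 ^ k)).ne
  exact proposition2p8_general two_ne_zero_of_isFormallyReal t _ (Sum.inl_injective.ne h)
    one_ne_zero one_ne_zero (map_one _).symm (map_one _).symm
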